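/- Let $\Bbbk$ be a field and let $\mathcal A$ be a commutative cancellative semigroup with zero, generated by $\mathbf a_1,\dots,\mathbf a_r$. Assume that $\mathcal A$ is combinatorially finite (each $\mathbf a\in\mathcal A\setminus\{0\}$ can be written in only finitely many ways as a sum of nonzero elements of $\mathcal A$) and that its associated commutative group $G(\mathcal A)$ is torsion free. Let $\mathcal S$ be the Lawrence lifting of $\mathcal A$, i.e. the subsemigroup of $G(\mathcal A)\oplus\mathbb Z^r$ generated by $(\mathbf a_1,\mathbf e_1),\dots,(\mathbf a_r,\mathbf e_r),(0,\mathbf e_1),\dots,(0,\mathbf e_r)$, where $\mathbf e_i$ is the $i$-th canonical basis vector of $\mathbb Z^r$. Let $I$ be the Lawrence ideal of $\mathcal A$, i.e. the kernel of the $\Bbbk$-algebra homomorphism $\Bbbk[X_1,\dots,X_r,Y_1,\dots,Y_r]\to\Bbbk[\mathcal S]$ given by $X_i\mapsto \mathbf t^{(\mathbf a_i,\mathbf e_i)}$, $Y_i\mapsto\mathbf t^{(0,\mathbf e_i)}$. Grade the polynomial ring by $\mathcal S$, with $\deg X_i=(\mathbf a_i,\mathbf e_i)$ and $\deg Y_i=(0,\mathbf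 e_i)$. A binomial is a polynomial with exactly two terms. A binomial $f\in I$ is called indispensable if it is homogeneous of some degree $\mathbf d\in\mathcal S$ and every minimal system of $\mathcal S$-homogeneous generators of $I$ contains one and only one polynomial of degree $\mathbf d$, and this polynomial is a nonzero scalar multiple of $f$. (Minimal means minimal with respect to inclusion.) Then $I$ is generated by its indispensable binomials. Hence $I$ has a unique minimal system of binomial generators, up to multiplication of its elements by nonzero scalars. -/

import Mathlib

noncomputable section

namespace SemigroupIdeal

/-- A commutative monoid is combinatorially finite if every nonzero element can be written in only
finitely many ways as a sum of nonzero elements (the order of the summands being irrelevant). -/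
def CombinatoriallyFinite (A : Type*) [AddCommMonoid A] : Prop :=
  ∀ b : A, b ≠ 0 → {s : Multiset A | 0 ∉ s ∧ s.sum = b}.Finite

section General

variable (k : Type*) [Field k] {σ : Type*} {S : Type*} [AddCommMonoid S] (g : σ → S)

/-- The ideal of the semigroup generated by the family `g`: the kernel of the map of `k`-algebras
`k[X_i : i ∈ σ] → k[S]` that sends `X_i` to the basis element `t ^ (g i)`. -/
def semigroupIdeal : Ideal (MvPolynomial σ k) :=
  RingHom.ker (MvPolynomial.aeval (R := k)
    (fun i => (AddMonoidAlgebra.single (g i) 1 : AddMonoidAlgebra k S)))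

variable {k} in
/-- A binomial: a polynomial with exactly two terms. -/
def IsBinomial (f : MvPolynomial σ k) : Prop :=
  f.support.card = 2

/-- `B` is a system of binomial generators of the semigroup ideal. -/
def IsBinomialSystem (B : Set (MvPolynomial σ k)) : Prop :=
  (∀ f ∈ B, IsBinomial f) ∧ Ideal.span B = semigroupIdeal k g

/-- `B` is a system of generators of the semigroup ideal that are homogeneous for the
`S`-grading in which `X_i` has degree `g i`. -/
def IsHomogeneousSystem (B : Set (MvPolynomial σ k)) : Prop :=
  (∀ f ∈ B, ∃ d : S, MvPolynomial.IsWeightedHomogeneous g f d) ∧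
    Ideal.span B = semigroupIdeal k g

/-- `f` is an indispensable binomial of the semigroup ideal: it is a binomial in the ideal,
homogeneous of some degree `d` in the `S`-grading, and every minimal system of `S`-homogeneous
generators has one and only one element of degree `d`, namely `f` up to a nonzero scalar. -/
def IsIndispensableBinomial (f : MvPolynomial σ k) : Prop :=
  IsBinomial f ∧ f ∈ semigroupIdeal k g ∧
    ∃ d : S, MvPolynomial.IsWeightedHomogeneous g f d ∧
      ∀ B : Set (MvPolynomial σ k), Minimal (IsHomogeneousSystem k g) B →
        ∃ c : kˣ, {h ∈ B | MvPolynomial.IsWeightedHomogeneous g h d} = {c • f}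

end General

section Lawrence

variable {A : Type*} [AddCommMonoid A] {r : ℕ} (a : Fin r → A)

/-- The elements `(a_1, e_1), …, (a_r, e_r), (0, e_1), …, (0, e_r)` of `G(A) ⊕ ℤ^r`, where `G(A)`
is the associated commutative group of `A`. -/
def lawrenceVector : Fin r ⊕ Fin r → Algebra.GrothendieckAddGroup A × (Fin r → ℤ)
  | Sum.inl i => (Algebra.GrothendieckAddGroup.of (a i), Pi.single i 1)
  | Sum.inr i => (0, Pi.single i 1)

/-- The Lawrence lifting: the subsemigroup of `G(A) ⊕ ℤ^r` generated by these elements. -/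
def lawrenceLifting : AddSubmonoid (Algebra.GrothendieckAddGroup A × (Fin r → ℤ)) :=
  AddSubmonoid.closure (Set.range (lawrenceVector a))

/-- The chosen generators of the Lawrence lifting, as elements of it. -/
def lawrenceGenerator (i : Fin r ⊕ Fin r) : lawrenceLifting a :=
  ⟨lawrenceVector a i, AddSubmonoid.subset_closure ⟨i, rfl⟩⟩

/-- The Lawrence ideal, in `k[X_1, …, X_r, Y_1, …, Y_r]`: the variable `Sum.inl i` is `X_i` and
`Sum.inr i` is `Y_i`. -/
def lawrenceIdeal (k : Type*) [Field k] : Ideal (MvPolynomial (Fin r ⊕ Fin r) k) :=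
  semigroupIdeal k (lawrenceGenerator a)

end Lawrence

end SemigroupIdeal

end

namespace SemigroupIdeal

open MvPolynomial

/-! ### Semigroup ideals and differences of monomials -/

section General

variable {k : Type*} [Field k] {σ : Type*} {S : Type*} [AddCommMonoid S] {g : σ → S}

/-! The `ℤ^r` component of a Lawrence weight fixes, for each `i`, the sum of the exponents of `X_i`
and `Y_i`. Hence a monomial coprime to `m` and of the same weight can only be `m` with every `X_i`
and `Y_i` exchanged (`apply_eq_of_disjoint`), so each monomial has at most one coprime partner.

This suffices for generation (`span_primitiveBinomials`). By induction on the degree, common factors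
are cancelled. If `m`, `m'` are coprime and a third monomial `n` has their weight, then `n` is
coprime to neither, and `m - m' = (m - n) - (m' - n)` reduces both differences. What remains are the
primitive pairs, alone in their degree.

A primitive binomial spans its graded piece of the ideal and is no combination of elements of other
degrees, so every homogeneous system of generators contains a nonzero multiple of it
(`IsPrimitivePair.exists_smul_mem`). Indispensability and uniqueness follow. -/

lemma aeval_single_monomial (u : σ →₀ ℕ) (c : k) :
    aeval (R := k) (fun i => (AddMonoidAlgebra.single (g i) 1 : AddMonoidAlgebra k S))
      (monomial u c) = AddMonoidAlgebra.single (Finsupp.weight g u) c := by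
  rw [aeval_monomial, Finsupp.weight_apply]
  have h : ∀ v : σ →₀ ℕ,
      (v.prod fun i n => (AddMonoidAlgebra.single (g i) 1 : AddMonoidAlgebra k S) ^ n) =
        AddMonoidAlgebra.single (v.sum fun i n => n • g i) 1 := by
    intro v
    induction v using Finsupp.induction_linear with
    | zero => simp [AddMonoidAlgebra.one_def]
    | add x y hx hy =>
      classical
      rw [Finsupp.prod_add_index' (by simp) (by intros; rw [pow_add]),
        Finsupp.sum_add_index' (by simp) (by intros; rw [add_smul]), hx, hy,
        AddMonoidAlgebra.single_mul_single, one_mul]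
    | single i n =>
      rw [Finsupp.prod_single_index (by simp), Finsupp.sum_single_index (by simp),
        AddMonoidAlgebra.single_pow, one_pow]
  rw [h, ← Algebra.smul_def, AddMonoidAlgebra.smul_single, smul_eq_mul, mul_one]

lemma monomial_sub_monomial_mem {u v : σ →₀ ℕ} (h : Finsupp.weight g u = Finsupp.weight g v) :
    monomial u (1 : k) - monomial v 1 ∈ semigroupIdeal k g := by
  rw [semigroupIdeal, RingHom.mem_ker, map_sub, aeval_single_monomial, aeval_single_monomial, h,
    sub_self]

variable (k g) in
/-- The semigroup ideal is generated by differences of monomials of the same weight. -/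
lemma span_monomial_sub_monomial :
    Ideal.span {f : MvPolynomial σ k | ∃ u v : σ →₀ ℕ,
      Finsupp.weight g u = Finsupp.weight g v ∧ f = monomial u 1 - monomial v 1} =
      semigroupIdeal k g := by
  apply le_antisymm
  · rw [Ideal.span_le]
    rintro _ ⟨u, v, h, rfl⟩
    exact monomial_sub_monomial_mem h
  · set K := Ideal.span {f : MvPolynomial σ k | ∃ u v : σ →₀ ℕ,
      Finsupp.weight g u = Finsupp.weight g v ∧ f = monomial u 1 - monomial v 1}
    let φ : MvPolynomial σ k →ₐ[k] AddMonoidAlgebra k S :=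
      aeval (R := k) (fun i => (AddMonoidAlgebra.single (g i) 1 : AddMonoidAlgebra k S))
    have key : ∀ p q : MvPolynomial σ k, φ p = φ q → p - q ∈ K := by
      -- One monomial is chosen per weight; the additive map `L` sends the semigroup algebra back to
      -- these, and `L ∘ φ` is the identity modulo `K`.
      let rep : S → (σ →₀ ℕ) := Function.invFun (Finsupp.weight g)
      have hrep : ∀ u, Finsupp.weight g (rep (Finsupp.weight g u)) = Finsupp.weight g u :=
        fun u => Function.invFun_eq ⟨u, rfl⟩
      let L : AddMonoidAlgebra k S →+ MvPolynomial σ k :=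
        (Finsupp.liftAddHom fun s => (monomial (rep s) : k →ₗ[k] MvPolynomial σ k).toAddMonoidHom).comp
          (AddMonoidAlgebra.coeffAddEquiv (R := k) (M := S)).toAddMonoidHom
      have hL : ∀ s c, L (AddMonoidAlgebra.single s c) = monomial (rep s) c := by
        intro s c
        simp [L]
      have h : ∀ p, p - L (φ p) ∈ K := by
        intro p
        induction p using MvPolynomial.induction_on' with
        | monomial u c =>
          have h1 : φ (monomial u c) = AddMonoidAlgebra.single (Finsupp.weight g u) c :=
            aeval_single_monomial u c
          rw [h1, hL]
          have h2 : monomial u c - monomial (rep (Finsupp.weight g u)) c =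
              C c * (monomial u (1 : k) - monomial (rep (Finsupp.weight g u)) 1) := by
            simp [mul_sub, C_mul_monomial]
          rw [h2]
          exact K.mul_mem_left _ (Ideal.subset_span ⟨_, _, (hrep u).symm, rfl⟩)
        | add p q hp hq =>
          have h3 : p + q - L (φ (p + q)) = (p - L (φ p)) + (q - L (φ q)) := by
            rw [map_add, map_add]; ring
          rw [h3]
          exact K.add_mem hp hq
      intro p q hpq
      have h4 := K.sub_mem (h p) (h q)
      rw [hpq] at h4
      convert h4 using 1
      ring
    intro p hp
    have h5 := key p 0 (by rw [map_zero]; exact hp)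
    rwa [sub_zero] at h5

/-- An element of the semigroup ideal supported on two monomials of the same weight is a multiple
of their difference. -/
lemma eq_smul_of_support_subset {m m' : σ →₀ ℕ} (hne : m ≠ m')
    (hw : Finsupp.weight g m = Finsupp.weight g m') {h : MvPolynomial σ k}
    (hI : h ∈ semigroupIdeal k g) (hs : ∀ u, coeff u h ≠ 0 → u = m ∨ u = m') :
    h = coeff m h • (monomial m (1 : k) - monomial m' 1) := by
  classical
  have h1 : h = monomial m (coeff m h) + monomial m' (coeff m' h) := by
    ext u
    rw [coeff_add, coeff_monomial, coeff_monomial]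
    by_cases hm : m = u
    · subst hm; simp [hne.symm]
    · by_cases hm' : m' = u
      · subst hm'; simp [hne]
      · simp only [hm, hm', if_false, add_zero]
        by_contra h0
        rcases hs u h0 with h | h
        · exact hm h.symm
        · exact hm' h.symm
  have h2 : coeff m h + coeff m' h = 0 := by
    rw [semigroupIdeal, RingHom.mem_ker, h1, map_add, aeval_single_monomial,
      aeval_single_monomial, ← hw, ← AddMonoidAlgebra.single_add] at hI
    simpa using congrArg (fun p => AddMonoidAlgebra.coeff p (Finsupp.weight g m)) hI
  have h3 : coeff m' h = - coeff m h := by linear_combination h2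
  conv_lhs => rw [h1, h3]
  simp [smul_monomial, sub_eq_add_neg]

/-- Every binomial of the semigroup ideal is homogeneous. -/
lemma IsBinomial.exists_isWeightedHomogeneous {f : MvPolynomial σ k} (hf : IsBinomial f)
    (hI : f ∈ semigroupIdeal k g) : ∃ d : S, IsWeightedHomogeneous g f d := by
  classical
  obtain ⟨m, m', hne, hs⟩ := Finset.card_eq_two.mp hf
  have hsum : f = monomial m (coeff m f) + monomial m' (coeff m' f) := by
    conv_lhs => rw [f.as_sum, hs, Finset.sum_pair hne]
  have hm : coeff m f ≠ 0 := by rw [← mem_support_iff, hs]; simp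
  have hw : Finsupp.weight g m = Finsupp.weight g m' := by
    by_contra hw
    rw [semigroupIdeal, RingHom.mem_ker, hsum, map_add, aeval_single_monomial,
      aeval_single_monomial] at hI
    have := congrArg (fun p => AddMonoidAlgebra.coeff p (Finsupp.weight g m)) hI
    simp [Ne.symm hw] at this
    exact hm this
  refine ⟨Finsupp.weight g m, fun {u} hu => ?_⟩
  rw [← mem_support_iff, hs, Finset.mem_insert, Finset.mem_singleton] at hu
  rcases hu with rfl | rfl
  · rfl
  · exact hw.symm

/-! ### Primitive pairs and indispensability -/

variable (g) in
/-- Two distinct coprime monomials (given by their exponents) that are the only ones of their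
weight. -/
structure IsPrimitivePair (m m' : σ →₀ ℕ) : Prop where
  ne : m ≠ m'
  weight_eq : Finsupp.weight g m = Finsupp.weight g m'
  disjoint : Disjoint m m'
  eq_or_eq : ∀ n, Finsupp.weight g n = Finsupp.weight g m → n = m ∨ n = m'

variable (k g) in
/-- The nonzero multiples of the differences of primitive pairs of monomials. -/
def primitiveBinomials : Set (MvPolynomial σ k) :=
  {f | ∃ (c : kˣ) (m m' : σ →₀ ℕ), IsPrimitivePair g m m' ∧
    f = c • (monomial m (1 : k) - monomial m' 1)}

lemma smul_mem_primitiveBinomials {f : MvPolynomial σ k} (c : kˣ)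
    (hf : f ∈ primitiveBinomials k g) : c • f ∈ primitiveBinomials k g := by
  obtain ⟨b, m, m', h, rfl⟩ := hf
  exact ⟨c * b, m, m', h, (mul_smul _ _ _).symm⟩

lemma IsPrimitivePair.support_eq {m m' : σ →₀ ℕ} (h : IsPrimitivePair g m m') (c : kˣ)
    [DecidableEq σ] :
    (c • (monomial m (1 : k) - monomial m' 1)).support = {m, m'} := by
  ext u
  have hne := h.ne
  rw [mem_support_iff, Units.smul_def, coeff_smul, coeff_sub, coeff_monomial, coeff_monomial,
    Finset.mem_insert, Finset.mem_singleton, smul_eq_mul]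
  by_cases hm : m = u
  · subst hm; simp [hne.symm]
  · by_cases hm' : m' = u
    · subst hm'; simp [hne]
    · simp [hm, hm', Ne.symm hm, Ne.symm hm']

lemma isBinomial_of_mem_primitiveBinomials {f : MvPolynomial σ k}
    (hf : f ∈ primitiveBinomials k g) : IsBinomial f := by
  classical
  obtain ⟨c, m, m', h, rfl⟩ := hf
  rw [IsBinomial, h.support_eq, Finset.card_pair h.ne]

lemma mem_semigroupIdeal_of_mem_primitiveBinomials {f : MvPolynomial σ k}
    (hf : f ∈ primitiveBinomials k g) : f ∈ semigroupIdeal k g := by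
  obtain ⟨c, m, m', h, rfl⟩ := hf
  rw [Units.smul_def, smul_eq_C_mul]
  exact Ideal.mul_mem_left _ _ (monomial_sub_monomial_mem h.weight_eq)

/-- Only two monomials have this degree, so the graded piece of the ideal is a line. -/
lemma IsPrimitivePair.eq_smul {m m' : σ →₀ ℕ} (h : IsPrimitivePair g m m')
    {p : MvPolynomial σ k} (hI : p ∈ semigroupIdeal k g)
    (hp : IsWeightedHomogeneous g p (Finsupp.weight g m)) :
    p = coeff m p • (monomial m (1 : k) - monomial m' 1) :=
  eq_smul_of_support_subset h.ne h.weight_eq hI fun u hu => h.eq_or_eq u (hp hu)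

/-- Every homogeneous system of generators contains a nonzero multiple of the difference of each
primitive pair. -/
lemma IsPrimitivePair.exists_smul_mem {m m' : σ →₀ ℕ} (h : IsPrimitivePair g m m')
    {B : Set (MvPolynomial σ k)} (hB : IsHomogeneousSystem k g B) :
    ∃ c : kˣ, c • (monomial m (1 : k) - monomial m' 1) ∈ B := by
  classical
  by_contra hno
  -- Quantifying over `q` lets the span induction absorb multiplication by scalars of the ring.
  have key : ∀ p ∈ Ideal.span B, ∀ q, coeff m (q * p) = 0 := by
    intro p hp
    induction hp using Submodule.span_induction with
    | zero => simp
    | add x y _ _ hx hy => intro q; rw [mul_add, coeff_add, hx, hy, add_zero]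
    | smul a x _ hx => intro q; rw [smul_eq_mul, ← mul_assoc, hx]
    | mem b hb =>
      intro q
      rw [coeff_mul]
      refine Finset.sum_eq_zero fun ⟨x, y⟩ hxy => ?_
      rw [Finset.HasAntidiagonal.mem_antidiagonal] at hxy
      by_contra hne
      have hy : coeff y b ≠ 0 := right_ne_zero_of_mul hne
      have hbI : b ∈ semigroupIdeal k g := hB.2 ▸ Ideal.subset_span hb
      obtain ⟨e, he⟩ := hB.1 b hb
      have hmul : IsWeightedHomogeneous g (monomial x (1 : k) * b) (Finsupp.weight g m) := by
        have := (isWeightedHomogeneous_monomial g x (1 : k) rfl).mul he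
        rwa [← he hy, ← map_add, hxy] at this
      have hxb := h.eq_smul (Ideal.mul_mem_left _ (monomial x (1 : k)) hbI) hmul
      have hcm : coeff m (monomial x (1 : k) * b) = coeff y b := by
        rw [← hxy, coeff_monomial_mul, one_mul]
      have hcm' : coeff m' (monomial x (1 : k) * b) ≠ 0 := by
        rw [hxb, hcm]
        simpa [coeff_monomial, h.ne] using hy
      -- The product is a nonzero multiple of the primitive difference, so `x` divides both `m` and
      -- `m'`; coprimality gives `x = 0`, and `b` itself is the excluded multiple.
      have hxm' : x ≤ m' := by
        rw [coeff_monomial_mul'] at hcm'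
        by_contra hlt
        simp [hlt] at hcm'
      have hx : x = 0 := by
        simpa [bot_eq_zero] using h.disjoint (hxy ▸ le_self_add : x ≤ m) hxm'
      subst hx
      rw [hcm] at hxb
      refine hno ⟨Units.mk0 _ hy, ?_⟩
      rw [Units.smul_def, Units.val_mk0, ← hxb]
      simpa using hb
  have h1 := key _ (hB.2 ▸ monomial_sub_monomial_mem (k := k) h.weight_eq) 1
  simp [coeff_monomial, h.ne.symm] at h1

lemma exists_smul_mem_of_mem_primitiveBinomials {f : MvPolynomial σ k}
    (hf : f ∈ primitiveBinomials k g) {B : Set (MvPolynomial σ k)}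
    (hB : IsHomogeneousSystem k g B) : ∃ c : kˣ, c • f ∈ B := by
  obtain ⟨b, m, m', h, rfl⟩ := hf
  obtain ⟨c, hc⟩ := h.exists_smul_mem hB
  exact ⟨c * b⁻¹, by rwa [smul_smul, inv_mul_cancel_right]⟩

lemma isIndispensableBinomial_of_mem_primitiveBinomials {f : MvPolynomial σ k}
    (hf : f ∈ primitiveBinomials k g) : IsIndispensableBinomial k g f := by
  classical
  refine ⟨isBinomial_of_mem_primitiveBinomials hf,
    mem_semigroupIdeal_of_mem_primitiveBinomials hf, ?_⟩
  obtain ⟨b, m, m', h, hfe⟩ := id hf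
  have hsupp := h.support_eq b (k := k)
  rw [← hfe] at hsupp
  have hd : IsWeightedHomogeneous g f (Finsupp.weight g m) := by
    intro u hu
    rw [← mem_support_iff, hsupp, Finset.mem_insert, Finset.mem_singleton] at hu
    rcases hu with rfl | rfl
    · rfl
    · exact h.weight_eq.symm
  refine ⟨Finsupp.weight g m, hd, fun B hB => ?_⟩
  obtain ⟨c, hc⟩ := exists_smul_mem_of_mem_primitiveBinomials hf hB.prop
  refine ⟨c, Set.eq_singleton_iff_unique_mem.mpr ⟨⟨hc, ?_⟩, ?_⟩⟩
  · rw [Units.smul_def]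
    exact (weightedHomogeneousSubmodule k g _).smul_mem _ hd
  · rintro p ⟨hpB, hp⟩
    -- A second element `p` of this degree would be a multiple of `c • f`, hence removable from `B`.
    by_contra hne
    have hpe := h.eq_smul (hB.prop.2 ▸ Ideal.subset_span hpB) hp
    have hsys : IsHomogeneousSystem k g (B \ {p}) := by
      refine ⟨fun q hq => hB.prop.1 q hq.1, le_antisymm ?_ ?_⟩
      · rw [← hB.prop.2]
        exact Ideal.span_mono Set.sdiff_subset
      · rw [← hB.prop.2, Ideal.span_le]
        intro q hq
        by_cases hqp : q = p
        · rw [hqp, SetLike.mem_coe]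
          have hcmem : c • f ∈ Ideal.span (B \ {p}) :=
            Ideal.subset_span ⟨hc, fun h' => hne h'.symm⟩
          have : p = C (coeff m p * (↑(c * b)⁻¹ : k)) * (c • f) := by
            rw [← smul_eq_C_mul, hfe, smul_smul, Units.smul_def (c * b), smul_smul, mul_assoc,
              Units.inv_mul, mul_one]
            exact hpe
          have hmem := Ideal.mul_mem_left _ (C (coeff m p * (↑(c * b)⁻¹ : k))) hcmem
          rwa [← this] at hmem
        · exact Ideal.subset_span ⟨hq, hqp⟩
    exact (hB.le_of_le hsys Set.sdiff_subset hpB).2 rfl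

/-! ### Generation and uniqueness -/

/-- If monomials of the same weight have the same degree and each monomial is coprime to at most
one monomial of its weight, then the primitive binomials generate the semigroup ideal. -/
lemma span_primitiveBinomials [IsCancelAdd S]
    (hdeg : ∀ m n : σ →₀ ℕ, Finsupp.weight g m = Finsupp.weight g n → m.degree = n.degree)
    (huniq : ∀ m n n' : σ →₀ ℕ, Finsupp.weight g n = Finsupp.weight g m →
      Finsupp.weight g n' = Finsupp.weight g m → Disjoint m n → Disjoint m n' → n = n') :
    Ideal.span (primitiveBinomials k g) = semigroupIdeal k g := by
  apply le_antisymm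
  · rw [Ideal.span_le]
    exact fun f hf => mem_semigroupIdeal_of_mem_primitiveBinomials hf
  rw [← span_monomial_sub_monomial, Ideal.span_le]
  rintro _ ⟨m, m', hw, rfl⟩
  rw [SetLike.mem_coe]
  set K := Ideal.span (primitiveBinomials k g)
  induction hN : m.degree using Nat.strong_induction_on generalizing m m' with
  | _ N ih =>
  have reduce : ∀ x y : σ →₀ ℕ, x.degree = N → Finsupp.weight g x = Finsupp.weight g y →
      ¬ Disjoint x y → monomial x (1 : k) - monomial y 1 ∈ K := by
    intro x y hx hxy hdis
    obtain ⟨u, hu⟩ := exists_add_of_le (inf_le_left : x ⊓ y ≤ x)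
    obtain ⟨v, hv⟩ := exists_add_of_le (inf_le_right : x ⊓ y ≤ y)
    have hc : x ⊓ y ≠ 0 := fun h0 => hdis (disjoint_iff.mpr h0)
    have hpos : 0 < (x ⊓ y).degree := by
      rw [Nat.pos_iff_ne_zero, Ne, Finsupp.degree_eq_zero_iff]; exact hc
    generalize x ⊓ y = c at hu hv hc hpos
    subst hu hv
    rw [map_add] at hx
    rw [map_add, map_add] at hxy
    have h1 := ih u.degree (by omega) u v (add_left_cancel hxy) rfl
    have h2 : monomial (c + u) (1 : k) - monomial (c + v) 1 =
        monomial c 1 * (monomial u 1 - monomial v 1) := by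
      simp [mul_sub, monomial_mul]
    rw [h2]
    exact K.mul_mem_left _ h1
  by_cases hne : m = m'
  · simp [hne]
  by_cases hdis : Disjoint m m'
  · by_cases hall : ∀ n, Finsupp.weight g n = Finsupp.weight g m → n = m ∨ n = m'
    · exact Ideal.subset_span ⟨1, m, m', ⟨hne, hw, hdis, hall⟩, (one_smul _ _).symm⟩
    · push Not at hall
      -- By `huniq`, the third monomial `n` shares a factor with `m` and with `m'`; `hdeg` makes
      -- `reduce` applicable to `m'` too.
      obtain ⟨n, hn, hnm, hnm'⟩ := hall
      have h1 := reduce m n hN hn.symm fun hd => hnm' (huniq m n m' hn hw.symm hd hdis)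
      have h2 := reduce m' n ((hdeg _ _ hw).symm.trans hN) (hw.symm.trans hn.symm)
        fun hd => hnm (huniq m' n m (hn.trans hw) hw hd hdis.symm)
      convert K.sub_mem h1 h2 using 1
      ring
  · exact reduce m m' hN hw hdis

lemma IsBinomialSystem.isHomogeneousSystem {B : Set (MvPolynomial σ k)}
    (hB : IsBinomialSystem k g B) : IsHomogeneousSystem k g B :=
  ⟨fun f hf => (hB.1 f hf).exists_isWeightedHomogeneous (hB.2 ▸ Ideal.subset_span hf), hB.2⟩

lemma span_isIndispensableBinomial
    (hspan : Ideal.span (primitiveBinomials k g) = semigroupIdeal k g) :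
    Ideal.span {f | IsIndispensableBinomial k g f} = semigroupIdeal k g := by
  apply le_antisymm
  · rw [Ideal.span_le]
    exact fun f hf => hf.2.1
  · rw [← hspan]
    exact Ideal.span_mono fun f hf => isIndispensableBinomial_of_mem_primitiveBinomials hf

/-- One representative of each `kˣ`-orbit of primitive binomials is enough to generate, and none can
be dropped, since every system meets every orbit. -/
lemma exists_minimal_isBinomialSystem
    (hspan : Ideal.span (primitiveBinomials k g) = semigroupIdeal k g) :
    ∃ B : Set (MvPolynomial σ k), Minimal (IsBinomialSystem k g) B ∧
      ∀ B' : Set (MvPolynomial σ k), Minimal (IsBinomialSystem k g) B' →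
        ∃ c : MvPolynomial σ k → kˣ, B' = (fun f => c f • f) '' B := by
  classical
  let rep : MvPolynomial σ k → MvPolynomial σ k := fun f =>
    (Quotient.mk (MulAction.orbitRel kˣ (MvPolynomial σ k)) f).out
  have hrep : ∀ f, ∃ c : kˣ, c • f = rep f := fun f =>
    MulAction.orbitRel_apply.mp (Quotient.mk_out (s := MulAction.orbitRel kˣ _) f)
  have hrep_smul : ∀ (c : kˣ) f, rep (c • f) = rep f := fun c f =>
    congrArg Quotient.out (Quotient.sound (s := MulAction.orbitRel kˣ _) ⟨c, rfl⟩)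
  have hspan_of : ∀ D : Set (MvPolynomial σ k), D ⊆ primitiveBinomials k g →
      (∀ f ∈ primitiveBinomials k g, ∃ c : kˣ, c • f ∈ D) → IsBinomialSystem k g D := by
    refine fun D hD hD' => ⟨fun f hf => isBinomial_of_mem_primitiveBinomials (hD hf),
      le_antisymm (hspan ▸ Ideal.span_mono hD) ?_⟩
    rw [← hspan, Ideal.span_le]
    intro f hf
    obtain ⟨c, hc⟩ := hD' f hf
    have h1 : f = C (↑c⁻¹ : k) * (c • f) := by
      rw [← smul_eq_C_mul, ← Units.smul_def, inv_smul_smul]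
    rw [h1]
    exact Ideal.mul_mem_left _ _ (Ideal.subset_span hc)
  let B : Set (MvPolynomial σ k) := {f ∈ primitiveBinomials k g | rep f = f}
  have hBrep : ∀ f ∈ primitiveBinomials k g, ∃ c : kˣ, c • f ∈ B := by
    intro f hf
    obtain ⟨c, hc⟩ := hrep f
    exact ⟨c, smul_mem_primitiveBinomials c hf, by rw [hrep_smul, hc]⟩
  refine ⟨B, ⟨hspan_of B (fun f hf => hf.1) hBrep, ?_⟩, ?_⟩
  · intro D hD hDB f hf
    obtain ⟨c, hc⟩ := exists_smul_mem_of_mem_primitiveBinomials hf.1 hD.isHomogeneousSystem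
    have h1 : c • f = f := by
      rw [← (hDB hc).2, hrep_smul, hf.2]
    rwa [h1] at hc
  · intro B' hB'
    have hex : ∀ f, ∃ c : kˣ, f ∈ B → c • f ∈ B' := by
      intro f
      by_cases hf : f ∈ B
      · obtain ⟨c, hc⟩ :=
          exists_smul_mem_of_mem_primitiveBinomials hf.1 hB'.prop.isHomogeneousSystem
        exact ⟨c, fun _ => hc⟩
      · exact ⟨1, fun h => absurd h hf⟩
    choose c hc using hex
    -- The rescaled copy of `B` inside `B'` already generates, so minimality of `B'` forces
    -- equality.
    refine ⟨c, (hB'.eq_of_subset (hspan_of _ ?_ ?_) ?_).symm⟩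
    · rintro _ ⟨f, hf, rfl⟩
      exact smul_mem_primitiveBinomials _ hf.1
    · intro f hf
      obtain ⟨b, hb⟩ := hBrep f hf
      exact ⟨c (b • f) * b, b • f, hb, (mul_smul _ _ _).symm⟩
    · rintro _ ⟨f, hf, rfl⟩
      exact hc f hf

end General

/-! ### The Lawrence lifting -/

section Lawrence

variable {A : Type*} [AddCommMonoid A] {r : ℕ} (a : Fin r → A)

lemma weight_lawrenceGenerator_snd (m : Fin r ⊕ Fin r →₀ ℕ) (i : Fin r) :
    (Finsupp.weight (lawrenceGenerator a) m :
      Algebra.GrothendieckAddGroup A × (Fin r → ℤ)).2 i = m (Sum.inl i) + m (Sum.inr i) := by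
  rw [Finsupp.weight_apply, Finsupp.sum_fintype _ _ (by simp)]
  simp [lawrenceGenerator, lawrenceVector, Prod.snd_sum, Pi.single_apply]

variable {a} in
lemma add_eq_add_of_weight_lawrenceGenerator_eq {m n : Fin r ⊕ Fin r →₀ ℕ}
    (h : Finsupp.weight (lawrenceGenerator a) m = Finsupp.weight (lawrenceGenerator a) n)
    (i : Fin r) : m (Sum.inl i) + m (Sum.inr i) = n (Sum.inl i) + n (Sum.inr i) := by
  have h1 := weight_lawrenceGenerator_snd a m i
  rw [h, weight_lawrenceGenerator_snd] at h1
  exact_mod_cast h1.symm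

variable {a} in
-- Two pairs of naturals with equal sums and disjoint supports are swaps of each other.
lemma apply_eq_of_disjoint {m n : Fin r ⊕ Fin r →₀ ℕ}
    (h : Finsupp.weight (lawrenceGenerator a) n = Finsupp.weight (lawrenceGenerator a) m)
    (hd : Disjoint m n) (i : Fin r) :
    n (Sum.inl i) = m (Sum.inr i) ∧ n (Sum.inr i) = m (Sum.inl i) := by
  have h1 := add_eq_add_of_weight_lawrenceGenerator_eq h i
  have h2 : ∀ j, min (m j) (n j) = 0 := fun j =>
    DFunLike.congr_fun (disjoint_iff.mp hd) j
  have h3 := h2 (Sum.inl i)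
  have h4 := h2 (Sum.inr i)
  omega

lemma span_primitiveBinomials_lawrenceGenerator (k : Type*) [Field k] :
    Ideal.span (primitiveBinomials k (lawrenceGenerator a)) = lawrenceIdeal a k := by
  refine span_primitiveBinomials (fun m n h => ?_) (fun m n n' hn hn' hd hd' => ?_)
  · rw [Finsupp.degree_eq_sum, Finsupp.degree_eq_sum, Fintype.sum_sum_type, Fintype.sum_sum_type,
      ← Finset.sum_add_distrib, ← Finset.sum_add_distrib]
    exact Finset.sum_congr rfl fun i _ => add_eq_add_of_weight_lawrenceGenerator_eq h i
  · ext (i | i)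
    · rw [(apply_eq_of_disjoint hn hd i).1, (apply_eq_of_disjoint hn' hd' i).1]
    · rw [(apply_eq_of_disjoint hn hd i).2, (apply_eq_of_disjoint hn' hd' i).2]

end Lawrence

end SemigroupIdeal

theorem corollary3p5 {k : Type*} [Field k] {A : Type*} [AddCancelCommMonoid A]
    (hfin : SemigroupIdeal.CombinatoriallyFinite A)
    (htf : IsAddTorsionFree (Algebra.GrothendieckAddGroup A))
    {r : ℕ} (a : Fin r → A) (ha : AddSubmonoid.closure (Set.range a) = ⊤) :
    Ideal.span {f | SemigroupIdeal.IsIndispensableBinomial k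
        (SemigroupIdeal.lawrenceGenerator a) f} = SemigroupIdeal.lawrenceIdeal a k ∧
    ∃ B : Set (MvPolynomial (Fin r ⊕ Fin r) k),
      Minimal (SemigroupIdeal.IsBinomialSystem k (SemigroupIdeal.lawrenceGenerator a)) B ∧
      ∀ B' : Set (MvPolynomial (Fin r ⊕ Fin r) k),
        Minimal (SemigroupIdeal.IsBinomialSystem k (SemigroupIdeal.lawrenceGenerator a)) B' →
          ∃ c : MvPolynomial (Fin r ⊕ Fin r) k → kˣ, B' = (fun f => c f • f) '' B := by
  have h := SemigroupIdeal.span_primitiveBinomials_lawrenceGenerator a k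
  exact ⟨SemigroupIdeal.span_isIndispensableBinomial h,
    SemigroupIdeal.exists_minimal_isBinomialSystem h⟩
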